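/- All graphs are finite and simple. A plane triangulation is a plane graph all of whose faces (the outer face included) are bounded by triangles, and $P_k$ denotes the path on $k$ vertices. A subgraph of an edge-colored graph is rainbow if all of its edges have different colors. For integers $n \ge k$, let $ar_{\mathcal P}(n,P_k)$ be the maximum number of colors in an edge-coloring of a plane triangulation $T$ on $n$ vertices such that $T$ contains $P_k$ as a subgraph but no rainbow copy of $P_k$. Let $k$ and $n$ be integers with $n \ge k \ge 10$, and let $\varepsilon \in \{0,1\}$ be the remainder of $k$ modulo $2$. Then $$ar_{\mathcal P}(n,P_k) \ \ge\ \begin{cases} n+2k-12 & \text{if } k \le n < 3\lfloor k/2\rfloor+\varepsilon-5,\\[1mm] \dfrac{3n+9\lfloor k/2\rfloor+3\varepsilon-43}{2} & \text{if } 3\lfloor k/2\rfloor+\varepsilon-5 \le n \le 5\lfloor k/2\rfloor+\varepsilon-15,\\[2mm] 2n+k-14 & \text{if } n > 5\lfloor k/2\rfloor+\varepsilon-15. \end{cases}$$ -/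

import Mathlib

namespace PlanarAntiRamsey

variable {V W : Type*}

/-- A combinatorial embedding of a graph in an oriented closed surface: at each vertex `v`,
the darts (oriented edges) leaving `v` are put in a cyclic order. `next d` is the dart that
follows `d` in the rotation around its initial vertex `d.fst`. -/
structure RotationSystem (G : SimpleGraph V) where
  next : Equiv.Perm G.Dart
  next_fst : ∀ d : G.Dart, (next d).fst = d.fst
  sameCycle : ∀ d e : G.Dart, d.fst = e.fst → next.SameCycle d e

namespace RotationSystem

variable {G : SimpleGraph V} (R : RotationSystem G)

/-- Reversal of darts. -/
def rev (G : SimpleGraph V) : Equiv.Perm G.Dart :=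
  Function.Involutive.toPerm SimpleGraph.Dart.symm SimpleGraph.Dart.symm_involutive

/-- The face permutation: walk along the dart `d = (u, v)` and leave `v` by the dart that follows
`(v, u)` in the rotation around `v`. -/
def facePerm : Equiv.Perm G.Dart := (rev G).trans R.next

/-- The faces of the embedding are the orbits of the face permutation, each orbit being the
closed boundary walk of one face. -/
def Face : Type _ := Quotient (Equiv.Perm.SameCycle.setoid R.facePerm)

/-- The embedding is in the plane (equivalently, in the sphere): the graph is connected, and Euler's
formula `|V| - |E| + |F| = 2` holds, so that the surface has genus zero. (The one-vertex graph,
which has no darts, does not count; it is no triangulation.) -/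
def IsPlane : Prop :=
  G.Connected ∧ Nat.card V + Nat.card R.Face = Nat.card G.edgeSet + 2

/-- Every face is bounded by a triangle: every face boundary walk closes after three steps. As `G`
is simple, such a walk runs through three different vertices. -/
def IsTriangulated : Prop :=
  ∀ d : G.Dart, R.facePerm (R.facePerm (R.facePerm d)) = d

end RotationSystem

/-- `G` is (the underlying graph of) a plane triangulation: it has an embedding in the plane all
of whose faces, the outer face included, are bounded by triangles. -/
def IsPlaneTriangulation (G : SimpleGraph V) : Prop :=
  ∃ R : RotationSystem G, R.IsPlane ∧ R.IsTriangulated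

/-- The edge-colored graph `G` has a rainbow copy of `H`: a subgraph isomorphic to `H` whose edges
all have different colors. -/
def HasRainbowCopy {K : Type*} (G : SimpleGraph V) (c : G.EdgeLabeling K) (H : SimpleGraph W) :
    Prop :=
  ∃ S : G.Subgraph, Nonempty (H ≃g S.coe) ∧
    ∀ e f : G.edgeSet, (e : Sym2 V) ∈ S.edgeSet → (f : Sym2 V) ∈ S.edgeSet → c e = c f → e = f

/-- The numbers `m` such that some plane triangulation on `n` vertices which contains `H` as a
subgraph has an edge-coloring with exactly `m` colors and without rainbow copy of `H`. -/
def colorCounts (n : ℕ) (H : SimpleGraph W) : Set ℕ :=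
  {m | ∃ T : SimpleGraph (Fin n), IsPlaneTriangulation T ∧ H.IsContained T ∧
    ∃ c : T.EdgeLabeling (Fin m), Function.Surjective c ∧ ¬ HasRainbowCopy T c H}

/-- The supremum below is taken over a bounded set, so it is a maximum whenever some such coloring
exists. -/
theorem bddAbove_colorCounts (n : ℕ) (H : SimpleGraph W) : BddAbove (colorCounts n H) := by
  refine ⟨Nat.card (Sym2 (Fin n)), ?_⟩
  rintro m ⟨T, -, -, c, hc, -⟩
  have h1 := Nat.card_le_card_of_surjective c hc
  have h2 := Nat.card_le_card_of_injective (Subtype.val : T.edgeSet → Sym2 (Fin n))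
    Subtype.val_injective
  rw [Nat.card_fin] at h1
  exact h1.trans h2

/-- The planar anti-Ramsey number of `H`: the maximum number of colors in an edge-coloring, without
rainbow copy of `H`, of a plane triangulation on `n` vertices that contains `H` as a subgraph. -/
noncomputable def planarAntiRamsey (n : ℕ) (H : SimpleGraph W) : ℕ :=
  sSup (colorCounts n H)

end PlanarAntiRamsey

/-! Two colorings of stacked triangulations give all three bounds. Such a triangulation has a spine:
two adjacent poles, both joined to every vertex of a path. Further vertices of degree three, the
fillings, are placed in faces that contain a path edge and a pole.

Short range (`add_two_mul_le_planarAntiRamsey`): take `k - 3` spine vertices and `n + 3 - k`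
fillings, give the three edges at each filling one common color and every other edge its own. A
`k`-vertex path has `k - 2` inner vertices, so one of them is a filling and the path repeats a color
there. The number of colors is `3n - 6 - 2(n + 3 - k) = n + 2k - 12`.

Other ranges (`two_mul_add_three_mul_le_planarAntiRamsey`): call the first `s` spine vertices hubs
and place all fillings in faces whose corners are hubs. The edges that avoid the hubs form a tail of
the spine and share one color; all other edges have their own. At most `2s` edges of a path meet a
hub, so a rainbow path has at most `2s + 1` edges. This gives `2n + 3s - 10` colors, and `s = ⌊k/2⌋
- 2` suffices for both ranges.

Planarity is handled by `IsFaceSystem`, which describes a triangulated sphere on a vertex set inside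
one fixed ambient graph. It is preserved when a vertex is put into a face (`IsFaceSystem.insert`),
and it yields a plane triangulation (`IsFaceSystem.isPlaneTriangulation`).
`IsFaceSystem.ncard_image_le` then turns an edge coloring of the ambient graph into a lower bound.
-/

namespace PlanarAntiRamsey

/-! ### Face systems and triangulated embeddings -/

/-- The edges of `G` with both ends in `S`. -/
def edgesIn {V : Type*} (G : SimpleGraph V) (S : Finset V) : Set (Sym2 V) :=
  {e | e ∈ G.edgeSet ∧ ∀ x ∈ e, x ∈ S}

/-- `F` is the set of oriented faces of a triangulated sphere whose graph is the subgraph of `G`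
induced by `S`: each dart lies on exactly one oriented face, and the faces around a vertex form
a single cycle. Connectedness, of the links and of the graph, is stated in terms of predicates. -/
structure IsFaceSystem {V : Type*} (G : SimpleGraph V) (S : Finset V) (F : V → V → V → Prop) :
    Prop where
  mem : ∀ {u v w}, F u v w → u ∈ S
  adj : ∀ {u v w}, F u v w → G.Adj u v
  rot : ∀ {u v w}, F u v w → F v w u
  exists_face : ∀ {u v}, u ∈ S → v ∈ S → G.Adj u v → ∃ w, F u v w
  unique : ∀ {u v w w'}, F u v w → F u v w' → w = w'
  link : ∀ (u : V) (P : V → Prop), (∀ v w, F v u w → (P v ↔ P w)) →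
    ∀ v w, u ∈ S → v ∈ S → w ∈ S → G.Adj u v → G.Adj u w → P v → P w
  conn : ∀ P : V → Prop, (∀ u v, u ∈ S → v ∈ S → G.Adj u v → P u → P v) →
    ∀ u v, u ∈ S → v ∈ S → P u → P v
  nonempty : S.Nonempty
  card_edges : (edgesIn G S).ncard + 6 = 3 * S.card

theorem edgesIn_finite {V : Type*} (G : SimpleGraph V) (S : Finset V) :
    (edgesIn G S).Finite := by
  refine (S.sym2.finite_toSet).subset ?_
  rintro e ⟨-, he⟩
  exact Finset.mem_coe.2 (Finset.mem_sym2_iff.2 he)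

namespace RotationSystem

variable {V : Type*} {G : SimpleGraph V} (R : RotationSystem G)

theorem facePerm_fst (d : G.Dart) : (R.facePerm d).fst = d.snd :=
  R.next_fst _

theorem sameCycle_facePerm_iff (h : R.IsTriangulated) (d e : G.Dart) :
    R.facePerm.SameCycle d e ↔ e = d ∨ e = R.facePerm d ∨ e = R.facePerm (R.facePerm d) := by
  have h3 : R.facePerm ^ 3 = 1 := by
    ext1 x
    simpa [pow_succ] using h x
  constructor
  · rintro ⟨i, rfl⟩
    have hi : R.facePerm ^ i = R.facePerm ^ (i % 3) := by
      conv_lhs => rw [← Int.emod_add_mul_ediv i 3, zpow_add, zpow_mul]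
      have : R.facePerm ^ (3 : ℤ) = 1 := by exact_mod_cast h3
      rw [this, one_zpow, mul_one]
    rw [hi]
    have h0 : i % 3 = 0 ∨ i % 3 = 1 ∨ i % 3 = 2 := by omega
    rcases h0 with h0 | h0 | h0 <;> rw [h0]
    · left; simp
    · right; left; simp
    · right; right
      rw [show (2 : ℤ) = ((2 : ℕ) : ℤ) from rfl, zpow_natCast, pow_two]; rfl
  · rintro (rfl | rfl | rfl)
    · exact Equiv.Perm.SameCycle.refl _ _
    · exact ⟨1, by simp⟩
    · exact ⟨2, by rw [show (2 : ℤ) = ((2 : ℕ) : ℤ) from rfl, zpow_natCast, pow_two]; rfl⟩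

theorem facePerm_ne (d : G.Dart) : R.facePerm d ≠ d := by
  intro h
  have := R.facePerm_fst d
  rw [h] at this
  exact d.adj.ne this

/-- In a triangulated embedding, each face has exactly three darts. -/
theorem IsTriangulated.card_dart [Finite V] {R : RotationSystem G} (h : R.IsTriangulated) :
    Nat.card G.Dart = 3 * Nat.card R.Face := by
  classical
  have := Fintype.ofFinite V
  have : Fintype R.Face := @Fintype.ofFinite _ (Quotient.finite _)
  let q : G.Dart → R.Face := Quotient.mk _
  rw [Nat.card_eq_fintype_card, Nat.card_eq_fintype_card, ← Finset.card_univ,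
    Finset.card_eq_sum_card_fiberwise (f := q) (t := Finset.univ) (by simp)]
  rw [Finset.sum_const_nat (m := 3), Finset.card_univ, mul_comm]
  intro x _
  obtain ⟨d, rfl⟩ := Quotient.exists_rep x
  have hf : (Finset.univ.filter fun e => q e = ⟦d⟧)
      = {d, R.facePerm d, R.facePerm (R.facePerm d)} := by
    ext e
    simp only [Finset.mem_filter, Finset.mem_univ, true_and, Finset.mem_insert,
      Finset.mem_singleton]
    rw [← R.sameCycle_facePerm_iff h]
    refine Quotient.eq.trans ?_
    exact Equiv.Perm.sameCycle_comm
  rw [hf]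
  refine Finset.card_eq_three.2 ⟨_, _, _, (R.facePerm_ne d).symm, ?_, ?_, rfl⟩
  · intro h2
    have h3 := h d
    rw [← h2] at h3
    exact R.facePerm_ne d h3
  · exact (R.facePerm_ne _).symm

end RotationSystem

theorem comap_edgeSet_image {V W : Type*} {G : SimpleGraph V} {S : Finset V} {φ : W → V}
    (hφS : Set.range φ = S) : Sym2.map φ '' (G.comap φ).edgeSet = edgesIn G S := by
  have hmem : ∀ x, x ∈ S ↔ ∃ i, φ i = x := fun x => by
    rw [← Finset.mem_coe, ← hφS]; rfl
  ext e
  constructor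
  · rintro ⟨f, hf, rfl⟩
    induction f using Sym2.ind with
    | _ i j =>
      refine ⟨by simpa using hf, ?_⟩
      intro x hx
      simp only [Sym2.map_mk, Sym2.mem_iff] at hx
      rcases hx with rfl | rfl <;> exact (hmem _).2 ⟨_, rfl⟩
  · induction e using Sym2.ind with
    | _ u v =>
      rintro ⟨he, hS⟩
      obtain ⟨i, rfl⟩ := (hmem u).1 (hS u (Sym2.mem_mk_left _ _))
      obtain ⟨j, rfl⟩ := (hmem v).1 (hS v (Sym2.mem_mk_right _ _))
      exact ⟨s(i, j), by simpa using he, by simp⟩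

/-- The faces determine the rotation: around `u`, the dart `(u, v)` is followed by `(u, w)` where `F
v u w`. The face permutation then runs around the triples of `F`, and `link` says that the rotation
at each vertex is a single cycle. -/
theorem IsFaceSystem.isPlaneTriangulation {V W : Type*} [Finite W] {G : SimpleGraph V}
    {S : Finset V} {F : V → V → V → Prop} (h : IsFaceSystem G S F) {φ : W → V}
    (hφ : Function.Injective φ) (hφS : Set.range φ = S) :
    IsPlaneTriangulation (G.comap φ) := by
  classical
  have hmem : ∀ x, x ∈ S ↔ ∃ i, φ i = x := fun x => by
    rw [← Finset.mem_coe, ← hφS]; rfl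
  have hS : ∀ i, φ i ∈ S := fun i => (hmem _).2 ⟨i, rfl⟩
  set T := G.comap φ with hT
  -- The third corner is made a total function `th`; its values at non-adjacent pairs are
  -- irrelevant.
  have hex : ∀ u v : W, ∃ w, T.Adj u v → F (φ u) (φ v) (φ w) := by
    intro u v
    by_cases huv : T.Adj u v
    · obtain ⟨w, hw⟩ := h.exists_face (hS u) (hS v) huv
      obtain ⟨i, rfl⟩ := (hmem w).1 (h.mem (h.rot (h.rot hw)))
      exact ⟨i, fun _ => hw⟩
    · exact ⟨u, fun h => absurd h huv⟩
  choose th hth using hex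
  have hadj : ∀ {u v}, T.Adj u v → T.Adj u (th v u) := fun {u v} huv =>
    h.adj (h.rot (hth v u huv.symm))
  have hadj' : ∀ {u v}, T.Adj u v → T.Adj u (th u v) := fun {u v} huv =>
    (h.adj (h.rot (h.rot (hth u v huv)))).symm
  have hthu : ∀ {u v w}, F (φ u) (φ v) (φ w) → th u v = w := fun {u v w} huv =>
    hφ (h.unique (hth u v (h.adj huv)) huv)
  let nx : Equiv.Perm T.Dart :=
    { toFun := fun d => ⟨(d.fst, th d.snd d.fst), hadj d.adj⟩
      invFun := fun d => ⟨(d.fst, th d.fst d.snd), hadj' d.adj⟩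
      left_inv := by
        intro d
        ext
        · rfl
        · exact hthu (h.rot (hth d.snd d.fst d.adj.symm))
      right_inv := by
        intro d
        ext
        · rfl
        · exact hthu (h.rot (h.rot (hth d.fst d.snd d.adj))) }
  let R : RotationSystem T :=
    { next := nx
      next_fst := fun _ => rfl
      sameCycle := by
        intro d e hde
        -- The predicate singles out the far ends of the darts in the `nx`-cycle of `d`; by `link`
        -- it spreads to all neighbors.
        have key := h.link (φ d.fst)
          (fun w => ∃ e : T.Dart, e.fst = d.fst ∧ φ e.snd = w ∧ nx.SameCycle d e) ?_
          (φ d.snd) (φ e.snd) (hS _) (hS _) (hS _) d.adj (by rw [hde]; exact e.adj)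
          ⟨d, rfl, rfl, Equiv.Perm.SameCycle.refl _ _⟩
        · obtain ⟨e', h1, h2, h3⟩ := key
          have : e' = e := by
            ext
            · exact h1.trans hde
            · exact hφ h2
          rwa [this] at h3
        · intro v w hvw
          constructor
          · rintro ⟨e, h1, rfl, h3⟩
            refine ⟨nx e, h1, ?_, Equiv.Perm.sameCycle_apply_right.2 h3⟩
            exact h.unique (hth e.snd e.fst e.adj.symm) (h1 ▸ hvw)
          · rintro ⟨e, h1, rfl, h3⟩
            refine ⟨nx.symm e, h1, ?_, ?_⟩
            · exact h.unique (hth e.fst e.snd e.adj) (h1 ▸ h.rot hvw)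
            · rw [← Equiv.Perm.sameCycle_apply_right]
              simpa using h3 }
  have hface : ∀ d : T.Dart, (R.facePerm d).fst = d.snd ∧ (R.facePerm d).snd = th d.fst d.snd :=
    fun d => ⟨rfl, rfl⟩
  have htri : R.IsTriangulated := by
    intro d
    have f0 := hth _ _ d.adj
    ext
    · rw [(hface (R.facePerm (R.facePerm d))).1, (hface (R.facePerm d)).2, (hface d).1,
        (hface d).2]
      exact hthu (h.rot f0)
    · rw [(hface (R.facePerm (R.facePerm d))).2, (hface (R.facePerm d)).1,
        (hface (R.facePerm d)).2, (hface d).1, (hface d).2, hthu (h.rot f0)]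
      exact hthu (h.rot (h.rot f0))
  refine ⟨R, ⟨?_, ?_⟩, htri⟩
  · obtain ⟨x, hx⟩ := h.nonempty
    obtain ⟨r, rfl⟩ := (hmem x).1 hx
    have : Nonempty W := ⟨r⟩
    refine ⟨fun u v => ?_⟩
    obtain ⟨v', hv', hr⟩ := h.conn (fun w => ∃ i, φ i = w ∧ T.Reachable u i) (by
      rintro a b ha hb hab ⟨i, rfl, hi⟩
      obtain ⟨j, rfl⟩ := (hmem b).1 hb
      exact ⟨j, rfl, hi.trans (SimpleGraph.Adj.reachable (G := T) hab)⟩)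
      (φ u) (φ v) (hS _) (hS _) ⟨u, rfl, SimpleGraph.Reachable.refl _⟩
    rwa [hφ hv'] at hr
  -- Euler's formula: counting darts by faces and by edges gives `3|F| = 2|E|`, to be combined with
  -- `|E| = 3|V| - 6`.
  · have := Fintype.ofFinite W
    have hE : Nat.card T.edgeSet = (edgesIn G S).ncard := by
      rw [← comap_edgeSet_image hφS, Set.ncard_image_of_injective _ (Sym2.map.injective hφ)]
      rfl
    have hV : Nat.card W = S.card := by
      rw [← Set.ncard_coe_finset, ← hφS, ← Set.image_univ, Set.ncard_image_of_injective _ hφ,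
        Set.ncard_univ]
    have hD : Nat.card T.Dart = 2 * Nat.card T.edgeSet := by
      rw [Nat.card_eq_fintype_card, T.dart_card_eq_twice_card_edges,
        Nat.card_eq_fintype_card, SimpleGraph.edgeFinset_card]
    have hF := htri.card_dart
    have hc := h.card_edges
    omega

/-! ### Stacking vertices into faces -/

/-- The triple `(u, v, w)` is a rotation of `(a, b, c)`. -/
def IsRotation {V : Type*} (a b c u v w : V) : Prop :=
  (u = a ∧ v = b ∧ w = c) ∨ (u = b ∧ v = c ∧ w = a) ∨ (u = c ∧ v = a ∧ w = b)

theorem IsRotation.rotate {V : Type*} {a b c u v w : V} (h : IsRotation a b c u v w) :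
    IsRotation a b c v w u := by
  rcases h with h | h | h
  · exact Or.inr (Or.inl ⟨h.2.1, h.2.2, h.1⟩)
  · exact Or.inr (Or.inr ⟨h.2.1, h.2.2, h.1⟩)
  · exact Or.inl ⟨h.2.1, h.2.2, h.1⟩

/-- The oriented faces after a new vertex `x` is put into the face `(a, b, c)`. -/
def stackFaces {V : Type*} (F : V → V → V → Prop) (a b c x u v w : V) : Prop :=
  (F u v w ∧ ¬ IsRotation a b c u v w) ∨ IsRotation a b x u v w ∨ IsRotation b c x u v w ∨
    IsRotation c a x u v w

theorem edgesIn_insert {V : Type*} [DecidableEq V] {G : SimpleGraph V} {S : Finset V}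
    {a b c x : V} (ha : a ∈ S) (hb : b ∈ S) (hc : c ∈ S)
    (hadj : ∀ u ∈ S, G.Adj x u ↔ u = a ∨ u = b ∨ u = c) :
    edgesIn G (insert x S) = edgesIn G S ∪ {s(x, a), s(x, b), s(x, c)} := by
  ext e
  induction e using Sym2.ind with
  | _ u v =>
    simp only [edgesIn, SimpleGraph.mem_edgeSet, Sym2.mem_iff, Set.mem_ofPred_eq, Set.mem_union,
      Set.mem_insert_iff, Set.mem_singleton_iff, Finset.mem_insert, forall_eq_or_imp, forall_eq,
      Sym2.eq_iff]
    have hs : G.Adj u v ↔ G.Adj v u := G.adj_comm u v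
    have hirr : ¬ G.Adj x x := G.irrefl
    constructor
    · rintro ⟨h1, h2 | h2, h3 | h3⟩
      · subst h2; subst h3; exact absurd h1 hirr
      · subst h2
        rcases (hadj v h3).1 h1 with rfl | rfl | rfl <;> simp
      · subst h3
        rcases (hadj u h2).1 h1.symm with rfl | rfl | rfl <;> simp
      · exact Or.inl ⟨h1, h2, h3⟩
    · have h1 := (hadj a ha).2 (by simp)
      have h2 := (hadj b hb).2 (by simp)
      have h3 := (hadj c hc).2 (by simp)
      rintro (⟨h1, h2, h3⟩ | (⟨rfl, rfl⟩ | ⟨rfl, rfl⟩) | (⟨rfl, rfl⟩ | ⟨rfl, rfl⟩) |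
        (⟨rfl, rfl⟩ | ⟨rfl, rfl⟩)) <;> simp_all [SimpleGraph.adj_comm]

/-- The critical case is a dart on both an old and a new face. It avoids `x`, so it is a side of
`(a, b, c)`, and the old face on it is the one that was removed. -/
theorem IsFaceSystem.stackFaces_unique {V : Type*} {G : SimpleGraph V} {S : Finset V}
    {F : V → V → V → Prop} (h : IsFaceSystem G S F) {a b c x : V} (hF : F a b c) (hx : x ∉ S)
    (nab : a ≠ b) (nbc : b ≠ c) (nca : c ≠ a) {u v w w' : V} (h1 : stackFaces F a b c x u v w)
    (h2 : stackFaces F a b c x u v w') : w = w' := by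
  have F2 := h.rot hF
  have F3 := h.rot F2
  have nxa : x ≠ a := fun e => hx (e ▸ h.mem hF)
  have nxb : x ≠ b := fun e => hx (e ▸ h.mem F2)
  have nxc : x ≠ c := fun e => hx (e ▸ h.mem F3)
  have aux : ∀ z z', F u v z → ¬ IsRotation a b c u v z → IsRotation a b x u v z' ∨
      IsRotation b c x u v z' ∨ IsRotation c a x u v z' → z = z' := by
    intro z z' hz hr hz'
    have e1 : u ≠ x := fun e => hx (e ▸ h.mem hz)
    have e2 : v ≠ x := fun e => hx (e ▸ h.mem (h.rot hz))
    exfalso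
    rcases hz' with hz' | hz' | hz' <;> rcases hz' with ⟨rfl, rfl, -⟩ | ⟨-, rfl, -⟩ | ⟨rfl, -, -⟩
    all_goals first | exact e1 rfl | exact e2 rfl | skip
    · exact hr (Or.inl ⟨rfl, rfl, h.unique hz hF⟩)
    · exact hr (Or.inr (Or.inl ⟨rfl, rfl, h.unique hz F2⟩))
    · exact hr (Or.inr (Or.inr ⟨rfl, rfl, h.unique hz F3⟩))
  rcases h1 with ⟨h1, r1⟩ | h1
  · rcases h2 with ⟨h2, -⟩ | h2
    · exact h.unique h1 h2
    · exact aux _ _ h1 r1 h2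
  · rcases h2 with ⟨h2, r2⟩ | h2
    · exact (aux _ _ h2 r2 h1).symm
    · unfold IsRotation at h1 h2
      grind

theorem IsFaceSystem.insert {V : Type*} [DecidableEq V] {G : SimpleGraph V} {S : Finset V}
    {F : V → V → V → Prop} (h : IsFaceSystem G S F) {a b c x : V} (hF : F a b c) (hx : x ∉ S)
    (hadj : ∀ u ∈ S, G.Adj x u ↔ u = a ∨ u = b ∨ u = c) :
    IsFaceSystem G (insert x S) (stackFaces F a b c x) := by
  have F2 := h.rot hF
  have F3 := h.rot F2
  have ha := h.mem hF
  have hb := h.mem F2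
  have hc := h.mem F3
  have hab := h.adj hF
  have hbc := h.adj F2
  have hca := h.adj F3
  have hxa := (hadj a ha).2 (by simp)
  have hxb := (hadj b hb).2 (by simp)
  have hxc := (hadj c hc).2 (by simp)
  have nab := hab.ne
  have nbc := hbc.ne
  have nca := hca.ne
  have nxa := hxa.ne
  have nxb := hxb.ne
  have nxc := hxc.ne
  have hsupp : ∀ u v w, F u v w → u ≠ x ∧ v ≠ x ∧ w ≠ x := fun u v w hf =>
    ⟨fun e => hx (e ▸ h.mem hf), fun e => hx (e ▸ h.mem (h.rot hf)),
      fun e => hx (e ▸ h.mem (h.rot (h.rot hf)))⟩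
  have N1 : stackFaces F a b c x a b x := by simp [stackFaces, IsRotation]
  have N2 : stackFaces F a b c x b c x := by simp [stackFaces, IsRotation]
  have N3 : stackFaces F a b c x c a x := by simp [stackFaces, IsRotation]
  have hrot : ∀ {u v w}, stackFaces F a b c x u v w → stackFaces F a b c x v w u := by
    intro u v w hf
    rcases hf with ⟨hf, hr⟩ | hf | hf | hf
    · exact Or.inl ⟨h.rot hf, fun hr' => hr hr'.rotate.rotate⟩
    · exact Or.inr (Or.inl hf.rotate)
    · exact Or.inr (Or.inr (Or.inl hf.rotate))
    · exact Or.inr (Or.inr (Or.inr hf.rotate))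
  have hold : ∀ u v, u ∈ S → v ∈ S → G.Adj u v → ∃ w, stackFaces F a b c x u v w := by
    intro u v hu hv huv
    obtain ⟨w, hw⟩ := h.exists_face hu hv huv
    by_cases hr : IsRotation a b c u v w
    · rcases hr with ⟨rfl, rfl, rfl⟩ | ⟨rfl, rfl, rfl⟩ | ⟨rfl, rfl, rfl⟩
      exacts [⟨_, N1⟩, ⟨_, N2⟩, ⟨_, N3⟩]
    · exact ⟨w, Or.inl ⟨hw, hr⟩⟩
  refine ⟨?_, ?_, hrot, ?_, ?_, ?_, ?_, ⟨x, by simp⟩, ?_⟩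
  · rintro u v w (⟨hf, -⟩ | hf | hf | hf)
    · exact Finset.mem_insert_of_mem (h.mem hf)
    all_goals rcases hf with ⟨rfl, rfl, rfl⟩ | ⟨rfl, rfl, rfl⟩ | ⟨rfl, rfl, rfl⟩ <;> simp [*]
  · rintro u v w (⟨hf, -⟩ | hf | hf | hf)
    · exact h.adj hf
    all_goals
      rcases hf with ⟨rfl, rfl, rfl⟩ | ⟨rfl, rfl, rfl⟩ | ⟨rfl, rfl, rfl⟩ <;>
        first | assumption | (apply SimpleGraph.Adj.symm; assumption)
  · intro u v hu hv huv
    rcases Finset.mem_insert.1 hu with rfl | hu' <;>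
      rcases Finset.mem_insert.1 hv with rfl | hv'
    · exact absurd huv G.irrefl
    · rcases (hadj v hv').1 huv with rfl | rfl | rfl
      exacts [⟨_, hrot (hrot N1)⟩, ⟨_, hrot (hrot N2)⟩, ⟨_, hrot (hrot N3)⟩]
    · rcases (hadj u hu').1 huv.symm with rfl | rfl | rfl
      exacts [⟨_, hrot N3⟩, ⟨_, hrot N1⟩, ⟨_, hrot N2⟩]
    · exact hold u v hu' hv' huv
  · exact h.stackFaces_unique hF hx nab nbc nca
  · intro u P hP
    have hPa : u = a → (P c ↔ P x) ∧ (P x ↔ P b) := by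
      rintro rfl; exact ⟨hP _ _ N3, hP _ _ (hrot (hrot N1))⟩
    have hPb : u = b → (P a ↔ P x) ∧ (P x ↔ P c) := by
      rintro rfl; exact ⟨hP _ _ N1, hP _ _ (hrot (hrot N2))⟩
    have hPc : u = c → (P b ↔ P x) ∧ (P x ↔ P a) := by
      rintro rfl; exact ⟨hP _ _ N2, hP _ _ (hrot (hrot N3))⟩
    have hPx : u = x → (P b ↔ P a) ∧ (P c ↔ P b) := by
      rintro rfl; exact ⟨hP _ _ (hrot N1), hP _ _ (hrot N2)⟩
    -- In the link of a corner, the step across the removed face is replaced by two steps through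
    -- `x`.
    have hPold : ∀ v w, F v u w → (P v ↔ P w) := by
      intro v w hf
      by_cases hr : IsRotation a b c v u w
      · rcases hr with ⟨rfl, rfl, rfl⟩ | ⟨rfl, rfl, rfl⟩ | ⟨rfl, rfl, rfl⟩
        · rw [(hPb rfl).1, (hPb rfl).2]
        · rw [(hPc rfl).1, (hPc rfl).2]
        · rw [(hPa rfl).1, (hPa rfl).2]
      · exact hP v w (Or.inl ⟨hf, hr⟩)
    have hlink := h.link u P hPold
    -- In the link of an old vertex, `x` can be traded for an old neighbor, so the old link
    -- condition applies.
    have key : ∀ v, u ∈ S → v = x → G.Adj u v → ∃ v' ∈ S, G.Adj u v' ∧ (P v ↔ P v') := by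
      rintro v hu rfl huv
      rcases (hadj u hu).1 huv.symm with rfl | rfl | rfl
      · exact ⟨b, hb, hab, (hPa rfl).2⟩
      · exact ⟨c, hc, hbc, (hPb rfl).2⟩
      · exact ⟨a, ha, hca, (hPc rfl).2⟩
    intro v w hu hv hw huv huw hPv
    rcases Finset.mem_insert.1 hu with rfl | hu
    · have hv' : v ∈ S := (Finset.mem_insert.1 hv).resolve_left huv.ne'
      have hw' : w ∈ S := (Finset.mem_insert.1 hw).resolve_left huw.ne'
      obtain ⟨p1, p2⟩ := hPx rfl
      have hPa' : ∀ y ∈ S, G.Adj u y → (P y ↔ P a) := by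
        intro y hy huy
        rcases (hadj y hy).1 huy with e | e | e <;> rw [e]
        · exact p1
        · exact p2.trans p1
      exact (hPa' w hw' huw).2 ((hPa' v hv' huv).1 hPv)
    · have key' : ∀ v ∈ Insert.insert x S, G.Adj u v →
          ∃ v' ∈ S, G.Adj u v' ∧ (P v ↔ P v') := by
        intro v hv huv
        rcases Finset.mem_insert.1 hv with hv | hv
        · exact key v hu hv huv
        · exact ⟨v, hv, huv, Iff.rfl⟩
      obtain ⟨v', hv', huv', e1⟩ := key' v hv huv
      obtain ⟨w', hw', huw', e2⟩ := key' w hw huw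
      exact e2.2 (hlink v' w' hu hv' hw' huv' huw' (e1.1 hPv))
  · intro P hP u v hu hv hPu
    have hold' : ∀ u v, u ∈ S → v ∈ S → P u → P v :=
      h.conn P fun u v hu hv => hP u v (Finset.mem_insert_of_mem hu) (Finset.mem_insert_of_mem hv)
    have h1 := hP x a (Finset.mem_insert_self _ _) (Finset.mem_insert_of_mem ha) hxa
    have h2 := hP a x (Finset.mem_insert_of_mem ha) (Finset.mem_insert_self _ _) hxa.symm
    have h3 : P a := by
      rcases Finset.mem_insert.1 hu with rfl | hu
      exacts [h1 hPu, hold' u a hu ha hPu]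
    rcases Finset.mem_insert.1 hv with rfl | hv
    exacts [h2 h3, hold' a v ha hv h3]
  · rw [edgesIn_insert ha hb hc hadj, Set.ncard_union_eq ?_ ?_ (Set.toFinite _), Finset.card_insert_of_notMem hx]
    · have h3 : ({s(x, a), s(x, b), s(x, c)} : Set (Sym2 V)).ncard = 3 := by
        rw [Set.ncard_eq_three]
        refine ⟨_, _, _, ?_, ?_, ?_, rfl⟩ <;> simp <;> grind
      have := h.card_edges
      omega
    · rw [Set.disjoint_left]
      rintro e ⟨-, he⟩ h'
      apply hx
      simp only [Set.mem_insert_iff, Set.mem_singleton_iff] at h'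
      rcases h' with rfl | rfl | rfl <;> exact he x (Sym2.mem_mk_left _ _)
    · exact edgesIn_finite _ _

/-- Different faces can be filled independently: putting a vertex into one of them leaves the others
intact. -/
theorem IsFaceSystem.exists_fill {V : Type*} [DecidableEq V] {G : SimpleGraph V}
    {S : Finset V} {F : V → V → V → Prop} (h : IsFaceSystem G S F) (t : V → V × V × V)
    (X : Finset V) (hXS : Disjoint X S) (hF : ∀ x ∈ X, F (t x).1 (t x).2.1 (t x).2.2)
    (hadj : ∀ x ∈ X, ∀ u ∈ S, G.Adj x u ↔ u = (t x).1 ∨ u = (t x).2.1 ∨ u = (t x).2.2)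
    (hX : ∀ x ∈ X, ∀ y ∈ X, ¬ G.Adj x y)
    (ht : ∀ x ∈ X, ∀ y ∈ X, x ≠ y →
      ¬ IsRotation (t x).1 (t x).2.1 (t x).2.2 (t y).1 (t y).2.1 (t y).2.2) :
    ∃ F', IsFaceSystem G (X ∪ S) F' := by
  -- The induction must also remember that the faces reserved for vertices outside `Y` are still
  -- present.
  suffices H : ∀ Y ⊆ X, ∃ F', IsFaceSystem G (Y ∪ S) F' ∧
      ∀ x ∈ X, x ∉ Y → F' (t x).1 (t x).2.1 (t x).2.2 by
    obtain ⟨F', h', -⟩ := H X subset_rfl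
    exact ⟨F', h'⟩
  intro Y
  induction Y using Finset.induction_on with
  | empty => intro _; exact ⟨F, by simpa using h, fun x hx _ => hF x hx⟩
  | insert y Y hy ih =>
    intro hYX
    obtain ⟨F', h', hf⟩ := ih ((Finset.subset_insert _ _).trans hYX)
    have hyX : y ∈ X := hYX (Finset.mem_insert_self _ _)
    refine ⟨stackFaces F' (t y).1 (t y).2.1 (t y).2.2 y, ?_, ?_⟩
    · rw [Finset.insert_union]
      refine h'.insert (hf y hyX hy) ?_ ?_
      · rw [Finset.mem_union, not_or]
        exact ⟨hy, Finset.disjoint_left.1 hXS hyX⟩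
      · intro u hu
        by_cases huS : u ∈ S
        · exact hadj y hyX u huS
        · have huX : u ∈ X :=
            hYX (Finset.mem_insert_of_mem ((Finset.mem_union.1 hu).resolve_right huS))
          have hFy := hF y hyX
          constructor
          · exact fun hyu => absurd hyu (hX y hyX u huX)
          · rintro (rfl | rfl | rfl)
            exacts [absurd (h.mem hFy) huS, absurd (h.mem (h.rot hFy)) huS,
              absurd (h.mem (h.rot (h.rot hFy))) huS]
    · intro x hx hxY
      rw [Finset.mem_insert, not_or] at hxY
      exact Or.inl ⟨hf x hx hxY.2, ht y hyX x hx (Ne.symm hxY.1)⟩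

/-- The base of all stackings: a triangle on the sphere has two faces, one for each orientation. -/
theorem isFaceSystem_triangle {V : Type*} [DecidableEq V] {G : SimpleGraph V} {a b c : V}
    (hab : G.Adj a b) (hbc : G.Adj b c) (hca : G.Adj c a) :
    IsFaceSystem G {a, b, c} fun u v w => IsRotation a b c u v w ∨ IsRotation b a c u v w := by
  have nab := hab.ne
  have nbc := hbc.ne
  have nca := hca.ne
  have hba := hab.symm
  have hcb := hbc.symm
  have hac := hca.symm
  have hirr : ∀ x, ¬ G.Adj x x := fun x => G.irrefl
  refine ⟨?_, ?_, ?_, ?_, ?_, ?_, ?_, ⟨a, by simp⟩, ?_⟩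
  · simp only [Finset.mem_insert, Finset.mem_singleton]
    rintro u v w (h | h) <;> rcases h with h | h | h <;> simp [h.1]
  · unfold IsRotation
    rintro u v w
      ((⟨rfl, rfl, rfl⟩ | ⟨rfl, rfl, rfl⟩ | ⟨rfl, rfl, rfl⟩) |
        (⟨rfl, rfl, rfl⟩ | ⟨rfl, rfl, rfl⟩ | ⟨rfl, rfl, rfl⟩)) <;> assumption
  · exact fun h => h.imp IsRotation.rotate IsRotation.rotate
  · simp only [Finset.mem_insert, Finset.mem_singleton]
    unfold IsRotation
    rintro u v (h1 | h1 | h1) (h2 | h2 | h2) huv <;> rw [h1, h2] at huv <;>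
      first
      | exact absurd huv (hirr _)
      | (refine ⟨a, ?_⟩; simp [h1, h2]; done)
      | (refine ⟨b, ?_⟩; simp [h1, h2]; done)
      | (refine ⟨c, ?_⟩; simp [h1, h2]; done)
  · unfold IsRotation
    intro u v w w' h1 h2
    grind
  · intro u P hP v w hu hv hw huv huw
    simp only [Finset.mem_insert, Finset.mem_singleton] at hu hv hw
    have h1 : u = c → (P b ↔ P a) := fun e => hP b a (by simp [IsRotation, e])
    have h2 : u = a → (P c ↔ P b) := fun e => hP c b (by simp [IsRotation, e])
    have h3 : u = b → (P a ↔ P c) := fun e => hP a c (by simp [IsRotation, e])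
    grind
  · intro P hP u v hu hv
    have H : ∀ u v, u ∈ ({a, b, c} : Finset V) → v ∈ ({a, b, c} : Finset V) → P u → P v := by
      intro u v hu hv
      by_cases huv : u = v
      · rw [huv]; exact id
      · refine hP u v hu hv ?_
        simp only [Finset.mem_insert, Finset.mem_singleton] at hu hv
        grind
    exact H u v hu hv
  · have h3 : edgesIn G {a, b, c} = {s(a, b), s(b, c), s(c, a)} := by
      ext e
      induction e using Sym2.ind with
      | _ u v =>
        simp only [edgesIn, SimpleGraph.mem_edgeSet, Sym2.mem_iff, Set.mem_ofPred_eq,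
          Set.mem_insert_iff, Set.mem_singleton_iff, Finset.mem_insert, Finset.mem_singleton,
          forall_eq_or_imp, forall_eq, Sym2.eq_iff]
        grind
    rw [h3, Set.ncard_eq_three.2, Finset.card_eq_three.2]
    · exact ⟨_, _, _, nab, nca.symm, nbc, rfl⟩
    · refine ⟨_, _, _, ?_, ?_, ?_, rfl⟩ <;> simp <;> grind

/-! ### Paths and color counts -/

/-- `p 0, …, p (k - 1)` is a path in the subgraph of `G` induced by `S`. -/
structure IsPathIn {V : Type*} (G : SimpleGraph V) (S : Finset V) (k : ℕ) (p : ℕ → V) :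
    Prop where
  mem : ∀ i < k, p i ∈ S
  inj : ∀ i < k, ∀ j < k, p i = p j → i = j
  adj : ∀ i, i + 1 < k → G.Adj (p i) (p (i + 1))

theorem IsPathIn.of_le {V : Type*} {G : SimpleGraph V} {S : Finset V} {k l : ℕ} {p : ℕ → V}
    (h : IsPathIn G S l p) (hkl : k ≤ l) : IsPathIn G S k p :=
  ⟨fun i hi => h.mem i (by omega), fun i hi j hj => h.inj i (by omega) j (by omega),
    fun i hi => h.adj i (by omega)⟩

/-- The number of colors of an edge-coloring `C` of the triangulation induced by `S` is a lower
bound for the planar anti-Ramsey number of a path, if there is no rainbow path. -/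
theorem IsFaceSystem.ncard_image_le {V K : Type*} {G : SimpleGraph V} {S : Finset V}
    {F : V → V → V → Prop} (h : IsFaceSystem G S F) {k : ℕ} {p : ℕ → V}
    (hp : IsPathIn G S k p) (C : Sym2 V → K)
    (hC : ∀ q, IsPathIn G S k q →
      ∃ i j, i < j ∧ j + 1 < k ∧ C s(q i, q (i + 1)) = C s(q j, q (j + 1))) :
    (C '' edgesIn G S).ncard ≤ planarAntiRamsey S.card (SimpleGraph.pathGraph k) := by
  classical
  let φ : Fin S.card → V := fun i => (S.equivFin.symm i : V)
  have hφ : Function.Injective φ :=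
    Subtype.val_injective.comp S.equivFin.symm.injective
  have hφS : Set.range φ = S := by
    ext x
    constructor
    · rintro ⟨i, rfl⟩; exact (S.equivFin.symm i).2
    · intro hx; exact ⟨S.equivFin ⟨x, hx⟩, by simp [φ]⟩
  have hpre : ∀ x ∈ S, ∃ i, φ i = x := fun x hx => by
    rw [← Finset.mem_coe, ← hφS] at hx; exact hx
  set T := G.comap φ with hT
  have hfin : (C '' edgesIn G S).Finite := (edgesIn_finite G S).image C
  let e : (C '' edgesIn G S : Set K) ≃ Fin (C '' edgesIn G S).ncard :=
    haveI := hfin.to_subtype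
    Finite.equivFin _
  have hmemE : ∀ f : T.edgeSet, Sym2.map φ f ∈ edgesIn G S := fun f => by
    rw [← comap_edgeSet_image hφS]; exact ⟨f, f.2, rfl⟩
  let c : T.EdgeLabeling (Fin (C '' edgesIn G S).ncard) :=
    fun f => e ⟨C (Sym2.map φ f), Sym2.map φ f, hmemE f, rfl⟩
  refine le_csSup (bddAbove_colorCounts _ _) ⟨T, h.isPlaneTriangulation hφ hφS, ?_, c, ?_, ?_⟩
  · obtain ⟨x, hx⟩ := h.nonempty
    have : Nonempty (Fin S.card) := ⟨S.equivFin ⟨x, hx⟩⟩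
    choose! r hr using hpre
    refine ⟨⟨⟨fun i => r (p i), ?_⟩, ?_⟩⟩
    · intro i j hij
      change G.Adj (φ (r (p i))) (φ (r (p j)))
      rw [hr _ (hp.mem i i.2), hr _ (hp.mem j j.2)]
      rcases SimpleGraph.pathGraph_adj.1 hij with hij | hij
      · have := hp.adj i (by omega)
        rwa [hij] at this
      · have := hp.adj j (by omega)
        rw [hij] at this
        exact this.symm
    · intro i j hij
      have := congrArg φ hij
      simp only [RelHom.coeFn_mk] at this
      rw [hr _ (hp.mem i i.2), hr _ (hp.mem j j.2)] at this
      exact Fin.ext (hp.inj i i.2 j j.2 this)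
  · intro y
    obtain ⟨⟨_, f, hf, rfl⟩, hx⟩ := e.surjective y
    rw [← comap_edgeSet_image hφS] at hf
    obtain ⟨g, hg, rfl⟩ := hf
    exact ⟨⟨g, hg⟩, hx⟩
  · rintro ⟨U, ⟨ι⟩, hU⟩
    rcases Nat.eq_zero_or_pos k with rfl | hk
    · obtain ⟨i, j, -, hj, -⟩ := hC p hp
      omega
    let q' : ℕ → Fin S.card := fun i => if hi : i < k then (ι ⟨i, hi⟩ : Fin S.card)
      else (ι ⟨0, hk⟩ : Fin S.card)
    have hq' : ∀ i (hi : i < k), q' i = ι ⟨i, hi⟩ := fun i hi => dif_pos hi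
    have hadj : ∀ i, i + 1 < k → U.Adj (q' i) (q' (i + 1)) := by
      intro i hi
      rw [hq' i (by omega), hq' (i + 1) hi]
      have : U.coe.Adj (ι ⟨i, by omega⟩) (ι ⟨i + 1, hi⟩) :=
        ι.map_rel_iff.2 (SimpleGraph.pathGraph_adj.2 (Or.inl rfl))
      exact this
    have hinj : ∀ i < k, ∀ j < k, q' i = q' j → i = j := by
      intro i hi j hj hij
      rw [hq' i hi, hq' j hj] at hij
      simpa using ι.injective (Subtype.ext hij)
    obtain ⟨i, j, hij, hj, hCij⟩ := hC (fun i => φ (q' i))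
      ⟨fun i _ => by rw [← Finset.mem_coe, ← hφS]; exact ⟨_, rfl⟩,
        fun i hi j hj hij => hinj i hi j hj (hφ hij), fun i hi => U.adj_sub (hadj i hi)⟩
    have key := hU ⟨s(q' i, q' (i + 1)), U.adj_sub (hadj i (by omega))⟩
      ⟨s(q' j, q' (j + 1)), U.adj_sub (hadj j hj)⟩ (hadj i (by omega)) (hadj j hj)
      (congrArg e (Subtype.ext hCij))
    have key' := congrArg Subtype.val key
    simp only [Sym2.eq_iff] at key'
    rcases key' with ⟨h1, -⟩ | ⟨h1, -⟩
    · exact absurd (hinj i (by omega) j (by omega) h1) (by omega)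
    · exact absurd (hinj i (by omega) (j + 1) (by omega) h1) (by omega)

/-- If the edges in `D` are recolored by `κ` and the other edges keep colors of their own, then
at least `|E \ D| + |L|` colors occur, for any set `L` of colors that occur on `D`. -/
theorem le_ncard_recolor {α β : Type*} {E D : Set α} (κ : α → β) {L : Set β}
    (hE : E.Finite) (hL : L ⊆ κ '' (E ∩ D)) (C : α → α ⊕ β)
    (hCD : ∀ e ∈ D, C e = Sum.inr (κ e)) (hC : ∀ e, e ∉ D → C e = Sum.inl e) :
    E.ncard + L.ncard ≤ (C '' E).ncard + (E ∩ D).ncard := by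
  have h1 : Sum.inl '' (E \ D) ∪ Sum.inr '' L ⊆ C '' E := by
    rintro _ (⟨e, he, rfl⟩ | ⟨x, hx, rfl⟩)
    · exact ⟨e, he.1, hC e he.2⟩
    · obtain ⟨e, he, rfl⟩ := hL hx
      exact ⟨e, he.1, hCD e he.2⟩
  have hLf : L.Finite := ((hE.inter_of_left D).image κ).subset hL
  have h2 := Set.ncard_le_ncard h1 (hE.image C)
  rw [Set.ncard_union_eq ?_ ((hE.sdiff).image _) (hLf.image _),
    Set.ncard_image_of_injective _ Sum.inl_injective,
    Set.ncard_image_of_injective _ Sum.inr_injective] at h2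
  · have h3 := Set.ncard_inter_add_ncard_sdiff_eq_ncard E D hE
    omega
  · rw [Set.disjoint_left]
    rintro _ ⟨_, _, rfl⟩ ⟨_, _, h⟩
    exact Sum.inr_ne_inl h

/-! ### The stacked triangulations -/

/-- The vertices of the stacked triangulations used for the lower bounds. -/
inductive StackVertex
  | spine (i : ℕ)
  | left (i : ℕ)
  | right (i : ℕ)

open StackVertex

/-- `IsParent x y`: the vertex `x` is one of the corners of the face into which `y` is put. -/
inductive IsParent : StackVertex → StackVertex → Prop
  | spine_zero {i : ℕ} (hi : 1 ≤ i) : IsParent (spine 0) (spine i)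
  | spine_one {i : ℕ} (hi : 2 ≤ i) : IsParent (spine 1) (spine i)
  | spine_succ {i : ℕ} (hi : 2 ≤ i) : IsParent (spine i) (spine (i + 1))
  | left_pole (i : ℕ) : IsParent (spine 0) (left i)
  | left_self (i : ℕ) : IsParent (spine i) (left i)
  | left_succ (i : ℕ) : IsParent (spine (i + 1)) (left i)
  | right_pole (i : ℕ) : IsParent (spine 1) (right i)
  | right_self (i : ℕ) : IsParent (spine i) (right i)
  | right_succ (i : ℕ) : IsParent (spine (i + 1)) (right i)

theorem isParent_spine_spine {i j : ℕ} : IsParent (spine i) (spine j) ↔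
    (i = 0 ∧ 1 ≤ j) ∨ (i = 1 ∧ 2 ≤ j) ∨ (2 ≤ i ∧ j = i + 1) := by
  constructor
  · rintro ⟨⟩ <;> simp_all
  · rintro (⟨rfl, h⟩ | ⟨rfl, h⟩ | ⟨h, rfl⟩)
    exacts [.spine_zero h, .spine_one h, .spine_succ h]

theorem isParent_left {x : StackVertex} {j : ℕ} : IsParent x (left j) ↔
    x = spine 0 ∨ x = spine j ∨ x = spine (j + 1) := by
  constructor
  · rintro ⟨⟩ <;> simp
  · rintro (rfl | rfl | rfl)
    exacts [.left_pole j, .left_self j, .left_succ j]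

theorem isParent_right {x : StackVertex} {j : ℕ} : IsParent x (right j) ↔
    x = spine 1 ∨ x = spine j ∨ x = spine (j + 1) := by
  constructor
  · rintro ⟨⟩ <;> simp
  · rintro (rfl | rfl | rfl)
    exacts [.right_pole j, .right_self j, .right_succ j]

theorem not_isParent_left {i : ℕ} {y : StackVertex} : ¬ IsParent (left i) y := by
  rintro ⟨⟩

theorem not_isParent_right {i : ℕ} {y : StackVertex} : ¬ IsParent (right i) y := by
  rintro ⟨⟩

/-- The poles `spine 0` and `spine 1` are joined to each other and to all vertices of the path
`spine 2, spine 3, …`; the vertices `left i` and `right i` fill the two triangles that the edge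
from `spine i` to `spine (i + 1)` spans with the poles. -/
def stackGraph : SimpleGraph StackVertex where
  Adj x y := IsParent x y ∨ IsParent y x
  symm := ⟨fun _ _ h => h.symm⟩
  loopless := ⟨by
    intro x h
    have h' : IsParent x x := h.elim id id
    cases x with
    | spine i => rw [isParent_spine_spine] at h'; omega
    | left i => exact not_isParent_left h'
    | right i => exact not_isParent_right h'⟩

theorem stackGraph_adj {x y : StackVertex} :
    stackGraph.Adj x y ↔ IsParent x y ∨ IsParent y x := Iff.rfl

theorem stackGraph_spine_adj {i j : ℕ} (hij : i < j) : stackGraph.Adj (spine j) (spine i) ↔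
    i = 0 ∨ i = 1 ∨ j = i + 1 := by
  rw [stackGraph_adj, isParent_spine_spine, isParent_spine_spine]
  omega

theorem stackGraph_left_adj {x : StackVertex} {j : ℕ} : stackGraph.Adj (left j) x ↔
    x = spine 0 ∨ x = spine j ∨ x = spine (j + 1) := by
  rw [stackGraph_adj, isParent_left, or_iff_right not_isParent_left]

theorem stackGraph_right_adj {x : StackVertex} {j : ℕ} : stackGraph.Adj (right j) x ↔
    x = spine 1 ∨ x = spine j ∨ x = spine (j + 1) := by
  rw [stackGraph_adj, isParent_right, or_iff_right not_isParent_right]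

def spineEmb : ℕ ↪ StackVertex := ⟨spine, fun _ _ h => spine.inj h⟩
def leftEmb : ℕ ↪ StackVertex := ⟨left, fun _ _ h => left.inj h⟩
def rightEmb : ℕ ↪ StackVertex := ⟨right, fun _ _ h => right.inj h⟩

@[simp] theorem spineEmb_apply (i : ℕ) : spineEmb i = spine i := rfl
@[simp] theorem leftEmb_apply (i : ℕ) : leftEmb i = left i := rfl
@[simp] theorem rightEmb_apply (i : ℕ) : rightEmb i = right i := rfl

open Classical in
/-- The fillings `left 2, …, left (a + 1)` and `right 2, …, right (b + 1)`. -/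
noncomputable def fillings (a b : ℕ) : Finset StackVertex :=
  (Finset.Ico 2 (a + 2)).map leftEmb ∪ (Finset.Ico 2 (b + 2)).map rightEmb

open Classical in
/-- The vertices `spine 0, …, spine N` and the fillings. -/
noncomputable def stackSet (N a b : ℕ) : Finset StackVertex :=
  fillings a b ∪ (Finset.range (N + 1)).map spineEmb

@[simp] theorem mem_spine_map {A : Finset ℕ} {x : StackVertex} :
    x ∈ A.map spineEmb ↔ ∃ i ∈ A, x = spine i := by
  simp [eq_comm]

@[simp] theorem spine_mem_fillings {a b i : ℕ} : spine i ∉ fillings a b := by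
  simp [fillings]

@[simp] theorem left_mem_fillings {a b i : ℕ} : left i ∈ fillings a b ↔ 2 ≤ i ∧ i < a + 2 := by
  simp [fillings]

@[simp] theorem right_mem_fillings {a b i : ℕ} :
    right i ∈ fillings a b ↔ 2 ≤ i ∧ i < b + 2 := by
  simp [fillings]

@[simp] theorem spine_mem_stackSet {N a b i : ℕ} : spine i ∈ stackSet N a b ↔ i ≤ N := by
  simp [stackSet]

@[simp] theorem left_mem_stackSet {N a b i : ℕ} :
    left i ∈ stackSet N a b ↔ 2 ≤ i ∧ i < a + 2 := by
  simp [stackSet]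

@[simp] theorem right_mem_stackSet {N a b i : ℕ} :
    right i ∈ stackSet N a b ↔ 2 ≤ i ∧ i < b + 2 := by
  simp [stackSet]

theorem card_fillings (a b : ℕ) : (fillings a b).card = a + b := by
  classical
  rw [fillings, Finset.card_union_of_disjoint, Finset.card_map, Finset.card_map, Nat.card_Ico,
    Nat.card_Ico]
  · omega
  · rw [Finset.disjoint_left]
    intro x hx hx'
    obtain ⟨i, -, rfl⟩ := Finset.mem_map.1 hx
    simp at hx'

theorem card_stackSet (N a b : ℕ) : (stackSet N a b).card = N + 1 + a + b := by
  classical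
  rw [stackSet, Finset.card_union_of_disjoint, Finset.card_map, card_fillings, Finset.card_range]
  · omega
  · rw [Finset.disjoint_left]
    intro x hx hx'
    obtain ⟨i, -, rfl⟩ := mem_spine_map.1 hx'
    exact spine_mem_fillings hx

/-- The faces of the spine which are filled later. -/
theorem exists_isFaceSystem_spine (N : ℕ) (hN : 2 ≤ N) :
    ∃ F, IsFaceSystem stackGraph ((Finset.range (N + 1)).map spineEmb) F ∧
      F (spine 0) (spine 1) (spine N) ∧ ∀ i, 2 ≤ i → i < N →
        F (spine i) (spine 0) (spine (i + 1)) ∧ F (spine 1) (spine i) (spine (i + 1)) := by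
  classical
  induction N, hN using Nat.le_induction with
  | base =>
    refine ⟨fun u v w => IsRotation (spine 0) (spine 1) (spine 2) u v w ∨
      IsRotation (spine 1) (spine 0) (spine 2) u v w, ?_, ?_, fun i h2 h3 => by omega⟩
    · have h10 : stackGraph.Adj (spine 0) (spine 1) :=
        ((stackGraph_spine_adj (by omega)).2 (by simp)).symm
      have h21 : stackGraph.Adj (spine 1) (spine 2) :=
        ((stackGraph_spine_adj (by omega)).2 (by simp)).symm
      have h20 : stackGraph.Adj (spine 2) (spine 0) :=
        (stackGraph_spine_adj (by omega)).2 (by simp)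
      have hS : (Finset.range (2 + 1)).map spineEmb = {spine 0, spine 1, spine 2} := by
        ext x
        simp [Finset.range_add_one]
        tauto
      rw [hS]
      exact isFaceSystem_triangle h10 h21 h20
    · exact Or.inl (Or.inl ⟨rfl, rfl, rfl⟩)
  | succ N hN ih =>
    obtain ⟨F, hF, h0, hf⟩ := ih
    have hS : (Finset.range (N + 1 + 1)).map spineEmb =
        insert (spine (N + 1)) ((Finset.range (N + 1)).map spineEmb) := by
      rw [Finset.range_add_one, Finset.map_insert]; rfl
    -- The new spine vertex goes into the face `(0, 1, N)`. Of the three faces created, `(0, 1, N +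
    -- 1)` takes the next spine vertex and the other two may receive fillings.
    refine ⟨stackFaces F (spine 0) (spine 1) (spine N) (spine (N + 1)), ?_, ?_, ?_⟩
    · rw [hS]
      refine hF.insert h0 (by simp) ?_
      intro u hu
      obtain ⟨i, hi, rfl⟩ := mem_spine_map.1 hu
      rw [Finset.mem_range] at hi
      rw [stackGraph_spine_adj hi]
      simp only [spine.injEq]
      omega
    · simp [stackFaces, IsRotation]
    · intro i h2 hi
      rcases Nat.lt_succ_iff_lt_or_eq.1 hi with hi | rfl
      · obtain ⟨h3, h4⟩ := hf i h2 hi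
        refine ⟨Or.inl ⟨h3, ?_⟩, Or.inl ⟨h4, ?_⟩⟩ <;>
          simp only [IsRotation, spine.injEq] <;> omega
      · simp [stackFaces, IsRotation]

/-- The bounds on `a` and `b` ensure that the last fillings, `left (a + 1)` and `right (b + 1)`,
have their corners `spine (a + 2)` and `spine (b + 2)` on the spine. -/
theorem exists_isFaceSystem (N a b : ℕ) (hN : 2 ≤ N) (ha : a + 2 ≤ N) (hb : b + 2 ≤ N) :
    ∃ F, IsFaceSystem stackGraph (stackSet N a b) F := by
  classical
  obtain ⟨F, hF, -, hf⟩ := exists_isFaceSystem_spine N hN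
  let t : StackVertex → StackVertex × StackVertex × StackVertex := fun x =>
    match x with
    -- A dummy value: only fillings are inserted.
    | spine i => (spine i, spine i, spine i)
    | left i => (spine i, spine 0, spine (i + 1))
    | right i => (spine 1, spine i, spine (i + 1))
  refine hF.exists_fill t (fillings a b) ?_ ?_ ?_ ?_ ?_
  · rw [Finset.disjoint_left]
    intro x hx hx'
    obtain ⟨i, -, rfl⟩ := mem_spine_map.1 hx'
    exact spine_mem_fillings hx
  · rintro (i | i | i) hx
    · exact absurd hx spine_mem_fillings
    · rw [left_mem_fillings] at hx
      exact (hf i (by omega) (by omega)).1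
    · rw [right_mem_fillings] at hx
      exact (hf i (by omega) (by omega)).2
  · rintro (i | i | i) hx u hu
    · exact absurd hx spine_mem_fillings
    · rw [stackGraph_left_adj]; simp only [t]; tauto
    · exact stackGraph_right_adj
  · rintro (i | i | i) hx (j | j | j) hy <;>
      simp_all [stackGraph_left_adj, stackGraph_right_adj]
  · rintro (i | i | i) hx (j | j | j) hy hxy
    all_goals
      simp only [spine_mem_fillings, left_mem_fillings, right_mem_fillings, ne_eq, left.injEq,
        right.injEq] at hx hy hxy
    all_goals
      simp only [t, IsRotation, spine.injEq]
      omega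

/-- The path `spine 2, left 2, spine 3, left 3, …, spine (a + 2), spine (a + 3), …, spine N,
spine 0, spine 1`. -/
def longPath (N a i : ℕ) : StackVertex :=
  if i < 2 * a then if i % 2 = 0 then spine (2 + i / 2) else left (2 + i / 2)
  else if i ≤ a + N - 2 then spine (2 + i - a)
  else if i = a + N - 1 then spine 0 else spine 1

/-- This path shows that the triangulations contain `P_k`: it uses the whole spine and all left
fillings, and an initial segment of it has `k` vertices. -/
theorem isPathIn_longPath (N a b : ℕ) (hN : 2 ≤ N) (ha : a + 2 ≤ N) :
    IsPathIn stackGraph (stackSet N a b) (a + N + 1) (longPath N a) := by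
  refine ⟨?_, ?_, ?_⟩
  · intro i hi
    unfold longPath
    split_ifs <;> simp <;> omega
  · intro i hi j hj
    unfold longPath
    split_ifs <;> simp only [spine.injEq, left.injEq, reduceCtorEq, false_imp_iff] <;> omega
  · intro i hi
    unfold longPath
    split_ifs <;> simp only [stackGraph_adj, isParent_spine_spine, isParent_left, spine.injEq,
      not_isParent_left, or_false, false_or, reduceCtorEq,
      true_and, false_and, and_true, and_false, true_or, or_true] <;> omega

/-! ### The two colorings -/

/-- Color the edges at each filling with one color, and give the other edges colors of their own:
a rainbow path runs through no filling except at its ends. -/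
theorem add_two_mul_le_planarAntiRamsey (n k : ℕ) (hk : 6 ≤ k) (hkn : k ≤ n)
    (hn : n + 9 ≤ 2 * k) :
    n + 2 * k ≤ planarAntiRamsey n (SimpleGraph.pathGraph k) + 12 := by
  classical
  -- The spine gets `N + 1 = k - 3` vertices, one fewer than a `k`-vertex path has inner vertices.
  -- The other `a` vertices are fillings, and `a ≥ 3` makes `longPath` long enough.
  obtain ⟨a, ha⟩ : ∃ a, n + 3 = k + a := ⟨n + 3 - k, by omega⟩
  obtain ⟨N, rfl⟩ : ∃ N, k = N + 4 := ⟨k - 4, by omega⟩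
  obtain ⟨F, hF⟩ := exists_isFaceSystem N a 0 (by omega) (by omega) (by omega)
  set S := stackSet N a 0 with hS
  set X := fillings a 0 with hX
  have hScard : S.card = n := by rw [hS, card_stackSet]; omega
  have hXmem : ∀ x, x ∈ X ↔ ∃ i, x = left i ∧ 2 ≤ i ∧ i < a + 2 := by
    rintro (i | i | i) <;> simp [hX]
    omega
  let D : Set (Sym2 StackVertex) := {e | ∃ x ∈ X, x ∈ e}
  let κ : Sym2 StackVertex → Set StackVertex := fun e => {x | x ∈ X ∧ x ∈ e}
  let C : Sym2 StackVertex → Sym2 StackVertex ⊕ Set StackVertex :=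
    fun e => if e ∈ D then Sum.inr (κ e) else Sum.inl e
  have hCD : ∀ e ∈ D, C e = Sum.inr (κ e) := fun e he => if_pos he
  have hC : ∀ e, e ∉ D → C e = Sum.inl e := fun e he => if_neg he
  -- No two fillings are adjacent, so the color of an edge at a filling names that filling alone.
  have hκ : ∀ x ∈ X, ∀ y, stackGraph.Adj x y → κ s(x, y) = {x} := by
    intro x hx y hxy
    obtain ⟨i, rfl, hi⟩ := (hXmem x).1 hx
    ext z
    simp only [κ, Sym2.mem_iff, Set.mem_ofPred_eq, Set.mem_singleton_iff]
    constructor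
    · rintro ⟨hz, rfl | rfl⟩
      · rfl
      · obtain ⟨j, rfl, -⟩ := (hXmem _).1 hz
        simp [stackGraph_left_adj] at hxy
    · rintro rfl
      exact ⟨hx, Or.inl rfl⟩
  have hcount := le_ncard_recolor (E := edgesIn stackGraph S) κ (L := (fun x => {x}) '' (X : Set _))
    (edgesIn_finite _ _) ?_ C hCD hC
  · rw [Set.ncard_image_of_injective _ Set.singleton_injective, Set.ncard_coe_finset,
      card_fillings] at hcount
    have hD : (edgesIn stackGraph S ∩ D).ncard ≤ a * 3 := by
      have hsub : edgesIn stackGraph S ∩ D ⊆ ((Finset.Ico 2 (a + 2)).biUnion fun i =>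
          ({s(left i, spine 0), s(left i, spine i), s(left i, spine (i + 1))} :
            Finset (Sym2 StackVertex)) : Finset _) := by
        rintro e ⟨⟨he, -⟩, x, hx, hxe⟩
        obtain ⟨i, rfl, h2, hi⟩ := (hXmem x).1 hx
        obtain ⟨y, rfl⟩ := Sym2.mem_iff_exists.1 hxe
        rw [Finset.mem_coe, Finset.mem_biUnion]
        refine ⟨i, Finset.mem_Ico.2 ⟨h2, hi⟩, ?_⟩
        rcases stackGraph_left_adj.1 he with rfl | rfl | rfl <;> simp
      refine (Set.ncard_le_ncard hsub (Finset.finite_toSet _)).trans ?_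
      rw [Set.ncard_coe_finset]
      refine (Finset.card_biUnion_le_card_mul _ _ 3 fun i _ => Finset.card_le_three).trans ?_
      rw [Nat.card_Ico]
      omega
    have hmain := hF.ncard_image_le (k := N + 4)
      ((isPathIn_longPath N a 0 (by omega) (by omega)).of_le (by omega)) C ?_
    · have hE := hF.card_edges
      rw [hScard] at hmain hE
      omega
    · intro q hq
      obtain ⟨i, hi1, hi2, hiX⟩ : ∃ i, 1 ≤ i ∧ i < N + 3 ∧ q i ∈ X := by
        by_contra! hcon
        have hle : (Finset.Ico 1 (N + 3)).card ≤ ((Finset.range (N + 1)).map spineEmb).card := by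
          refine Finset.card_le_card_of_injOn q ?_ ?_
          · intro i hi
            rw [Finset.mem_coe, Finset.mem_Ico] at hi
            have h1 := hq.mem i (by omega)
            rw [hS, stackSet, Finset.mem_union] at h1
            exact h1.resolve_left (hcon i hi.1 hi.2)
          · intro i hi j hj hij
            rw [Finset.mem_coe, Finset.mem_Ico] at hi hj
            exact hq.inj i (by omega) j (by omega) hij
        rw [Nat.card_Ico, Finset.card_map, Finset.card_range] at hle
        omega
      obtain ⟨i, rfl⟩ : ∃ j, i = j + 1 := ⟨i - 1, by omega⟩
      refine ⟨i, i + 1, by omega, by omega, ?_⟩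
      rw [hCD _ ⟨q (i + 1), hiX, by simp⟩, hCD _ ⟨q (i + 1), hiX, by simp⟩, Sym2.eq_swap,
        hκ _ hiX _ (hq.adj i (by omega)).symm, hκ _ hiX _ (hq.adj (i + 1) (by omega))]
  · rintro _ ⟨x, hx, rfl⟩
    obtain ⟨i, rfl, h2, hi⟩ := (hXmem x).1 hx
    have hadj : stackGraph.Adj (left i) (spine 0) := stackGraph_left_adj.2 (Or.inl rfl)
    refine ⟨s(left i, spine 0), ⟨⟨hadj, ?_⟩, left i, hx, by simp⟩, hκ _ hx _ hadj⟩
    intro y hy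
    rcases Sym2.mem_iff.1 hy with rfl | rfl <;> simp [hS, h2, hi]

/-- Color the edges that avoid a set of `s` hubs with one color, and give the other edges colors of
their own: a rainbow path has at most `2 * s + 1` edges. -/
theorem two_mul_add_three_mul_le_planarAntiRamsey (n k s : ℕ) (hs : 3 ≤ s) (hk : 2 * s + 3 ≤ k)
    (hkn : k + s ≤ n + 3) :
    2 * n + 3 * s ≤ planarAntiRamsey n (SimpleGraph.pathGraph k) + 10 := by
  classical
  -- The hubs are `spine 0, …, spine (a + 2)`. With `a` fillings on each side, `spine (a + 2)` is
  -- the last corner used, so every filling has only hubs as neighbors.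
  obtain ⟨a, rfl⟩ : ∃ a, s = a + 3 := ⟨s - 3, by omega⟩
  obtain ⟨N, hN⟩ : ∃ N, n = N + 1 + a + a := ⟨n - 1 - a - a, by omega⟩
  obtain ⟨F, hF⟩ := exists_isFaceSystem N a a (by omega) (by omega) (by omega)
  set S := stackSet N a a with hS
  have hScard : S.card = n := by rw [hS, card_stackSet]; omega
  let A : Finset StackVertex := (Finset.range (a + 3)).map spineEmb
  have hA : A.card = a + 3 := by simp [A]
  have hspineA : ∀ i, spine i ∈ A ↔ i < a + 3 := fun i => by simp [A]
  let D : Set (Sym2 StackVertex) := {e | ∀ x ∈ e, x ∉ A}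
  let C : Sym2 StackVertex → Sym2 StackVertex ⊕ Unit :=
    fun e => if e ∈ D then Sum.inr () else Sum.inl e
  have hCD : ∀ e ∈ D, C e = Sum.inr () := fun e he => if_pos he
  have hcount := le_ncard_recolor (E := edgesIn stackGraph S) (fun _ => ()) (L := {()})
    (edgesIn_finite _ _) ?_ C hCD fun e he => if_neg he
  · rw [Set.ncard_singleton] at hcount
    have hD : (edgesIn stackGraph S ∩ D).ncard ≤ N - (a + 3) := by
      have hsub : edgesIn stackGraph S ∩ D ⊆ ((Finset.Ico (a + 3) N).image fun i =>
          s(spine i, spine (i + 1)) : Finset _) := by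
        have hleft : ∀ i y, left i ∈ S → y ∉ A → ¬ stackGraph.Adj (left i) y := by
          intro i y hi hy hadj
          rw [hS, left_mem_stackSet] at hi
          rcases stackGraph_left_adj.1 hadj with rfl | rfl | rfl <;> rw [hspineA] at hy <;> omega
        have hright : ∀ i y, right i ∈ S → y ∉ A → ¬ stackGraph.Adj (right i) y := by
          intro i y hi hy hadj
          rw [hS, right_mem_stackSet] at hi
          rcases stackGraph_right_adj.1 hadj with rfl | rfl | rfl <;> rw [hspineA] at hy <;> omega
        rintro e ⟨⟨he, heS⟩, heD⟩
        induction e using Sym2.ind with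
        | _ u v =>
          have hu := heS u (by simp)
          have hv := heS v (by simp)
          have hu' := heD u (by simp)
          have hv' := heD v (by simp)
          rw [SimpleGraph.mem_edgeSet] at he
          rw [Finset.mem_coe, Finset.mem_image]
          match u, v with
          | left i, _ => exact absurd he (hleft _ _ hu hv')
          | right i, _ => exact absurd he (hright _ _ hu hv')
          | spine i, left j => exact absurd he.symm (hleft _ _ hv hu')
          | spine i, right j => exact absurd he.symm (hright _ _ hv hu')
          | spine i, spine j =>
            rw [hspineA] at hu' hv'
            rw [hS, spine_mem_stackSet] at hu hv
            rcases he with he | he <;> rw [isParent_spine_spine] at he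
            · obtain rfl : j = i + 1 := by omega
              exact ⟨i, Finset.mem_Ico.2 (by omega), rfl⟩
            · obtain rfl : i = j + 1 := by omega
              exact ⟨j, Finset.mem_Ico.2 (by omega), Sym2.eq_swap⟩
      refine (Set.ncard_le_ncard hsub (Finset.finite_toSet _)).trans ?_
      rw [Set.ncard_coe_finset]
      exact Finset.card_image_le.trans (Nat.card_Ico _ _).le
    have hmain := hF.ncard_image_le (k := k)
      ((isPathIn_longPath N a a (by omega) (by omega)).of_le (by omega)) C ?_
    · have hE := hF.card_edges
      rw [hScard] at hmain hE
      omega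
    · intro q hq
      set I := (Finset.range (k - 1)).filter fun i => s(q i, q (i + 1)) ∈ D with hI
      -- Each hub is the first end of at most one edge of the path and the second end of at most
      -- one. At least `k - 1 - 2 * s ≥ 2` edges therefore avoid the hubs.
      have hIcard : 1 < I.card := by
        set J := (Finset.range (k - 1)).filter fun i => q i ∈ A with hJ
        set J' := (Finset.range (k - 1)).filter fun i => q (i + 1) ∈ A with hJ'
        have hJcard : J.card ≤ A.card := by
          refine Finset.card_le_card_of_injOn q (fun i hi => (Finset.mem_filter.1 hi).2) ?_
          intro i hi j hj hij
          have h1 := Finset.mem_range.1 (Finset.mem_filter.1 hi).1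
          have h2 := Finset.mem_range.1 (Finset.mem_filter.1 hj).1
          exact hq.inj i (by omega) j (by omega) hij
        have hJ'card : J'.card ≤ A.card := by
          refine Finset.card_le_card_of_injOn (fun i => q (i + 1))
            (fun i hi => (Finset.mem_filter.1 hi).2) ?_
          intro i hi j hj hij
          have h1 := Finset.mem_range.1 (Finset.mem_filter.1 hi).1
          have h2 := Finset.mem_range.1 (Finset.mem_filter.1 hj).1
          have := hq.inj (i + 1) (by omega) (j + 1) (by omega) hij
          omega
        have hsub : Finset.range (k - 1) ⊆ I ∪ (J ∪ J') := by
          intro i hi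
          simp only [Finset.mem_union, hI, hJ, hJ', Finset.mem_filter, hi, true_and, D,
            Set.mem_ofPred_eq, Sym2.mem_iff, forall_eq_or_imp, forall_eq]
          tauto
        have h1 := Finset.card_le_card hsub
        have h2 := Finset.card_union_le I (J ∪ J')
        have h3 := Finset.card_union_le J J'
        rw [Finset.card_range] at h1
        omega
      obtain ⟨i, hi, j, hj, hij⟩ := Finset.one_lt_card.1 hIcard
      rw [hI, Finset.mem_filter, Finset.mem_range] at hi hj
      rcases Nat.lt_or_gt_of_ne hij with h | h
      · exact ⟨i, j, h, by omega, by rw [hCD _ hi.2, hCD _ hj.2]⟩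
      · exact ⟨j, i, h, by omega, by rw [hCD _ hi.2, hCD _ hj.2]⟩
  · rintro _ rfl
    -- The common color does occur: the hypotheses force `a + 4 ≤ N`, so the first edge of the tail
    -- exists.
    refine ⟨s(spine (a + 3), spine (a + 4)), ⟨⟨.inl (.spine_succ (by omega)), ?_⟩, ?_⟩, rfl⟩
    · intro x hx
      rcases Sym2.mem_iff.1 hx with rfl | rfl <;> rw [hS, spine_mem_stackSet] <;> omega
    · intro x hx
      rcases Sym2.mem_iff.1 hx with rfl | rfl <;> rw [hspineA] <;> omega

end PlanarAntiRamsey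

/-! ### Comparison with the three bounds -/

theorem theorem2p3 (n k ε : ℕ) (hk : 10 ≤ k) (hkn : k ≤ n) (hε : ε = k % 2) :
    ((n : ℤ) < 3 * ((k / 2 : ℕ) : ℤ) + ε - 5 →
      (n : ℝ) + 2 * k - 12 ≤
        (PlanarAntiRamsey.planarAntiRamsey n (SimpleGraph.pathGraph k) : ℝ)) ∧
    (3 * ((k / 2 : ℕ) : ℤ) + ε - 5 ≤ n → (n : ℤ) ≤ 5 * ((k / 2 : ℕ) : ℤ) + ε - 15 →
      (3 * (n : ℝ) + 9 * ((k / 2 : ℕ) : ℝ) + 3 * ε - 43) / 2 ≤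
        (PlanarAntiRamsey.planarAntiRamsey n (SimpleGraph.pathGraph k) : ℝ)) ∧
    (5 * ((k / 2 : ℕ) : ℤ) + ε - 15 < n →
      2 * (n : ℝ) + k - 14 ≤
        (PlanarAntiRamsey.planarAntiRamsey n (SimpleGraph.pathGraph k) : ℝ)) := by
  have hkt : k = 2 * (k / 2) + ε := by omega
  have hε1 : ε ≤ 1 := by omega
  generalize k / 2 = t at *
  refine ⟨fun h => ?_, fun h _ => ?_, fun h => ?_⟩
  · have key := PlanarAntiRamsey.add_two_mul_le_planarAntiRamsey n k (by omega) hkn (by omega)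
    have key' : (n : ℝ) + 2 * k ≤
        PlanarAntiRamsey.planarAntiRamsey n (SimpleGraph.pathGraph k) + 12 := by
      exact_mod_cast key
    linarith
  -- For `s = t - 2`, the condition `3 ≤ s` is `k ≥ 10`, and `k + s ≤ n + 3` is exactly the lower
  -- end of this range. The resulting `2n + 3t - 16` exceeds the bound claimed.
  · have key := PlanarAntiRamsey.two_mul_add_three_mul_le_planarAntiRamsey n k (t - 2)
      (by omega) (by omega) (by omega)
    have key' : 3 * n + 9 * t + 3 * ε ≤
        2 * PlanarAntiRamsey.planarAntiRamsey n (SimpleGraph.pathGraph k) + 43 := by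
      omega
    have key'' : 3 * (n : ℝ) + 9 * t + 3 * ε ≤
        2 * PlanarAntiRamsey.planarAntiRamsey n (SimpleGraph.pathGraph k) + 43 := by
      exact_mod_cast key'
    linarith
  -- The same choice works here: `t ≥ 5` gives `5t + ε - 14 ≥ 3t + ε - 5`, and `3t - 16 ≥ k - 14`.
  · have key := PlanarAntiRamsey.two_mul_add_three_mul_le_planarAntiRamsey n k (t - 2)
      (by omega) (by omega) (by omega)
    have key' : 2 * n + k ≤
        PlanarAntiRamsey.planarAntiRamsey n (SimpleGraph.pathGraph k) + 14 := by
      omega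
    have key'' : 2 * (n : ℝ) + k ≤
        PlanarAntiRamsey.planarAntiRamsey n (SimpleGraph.pathGraph k) + 14 := by
      exact_mod_cast key'
    linarith
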